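/- Let $\mathcal G$ be the set of all probability distributions on $(0,\infty)$. For $G\in\mathcal G$ and $\lambda>0$ let $I_1,I_2,\dots$ be i.i.d. exponential random variables with mean $1/\lambda$ and, independently of them, let $S_1,S_2,\dots$ be i.i.d. with distribution $G$; put $T_0=0$ and $T_n=I_1+\dots+I_n$. For $x\in[0,1]$ the workload process $(V^x_t)_{t\ge 0}$ of the M/G/1 queue with service truncated at capacity $1$ is defined by $V^x_0=x$, $$V^x_t=\max\bigl(V^x_{T_{n-1}}-(t-T_{n-1}),\,0\bigr)\quad (T_{n-1}\le t<T_n),\qquad V^x_{T_n}=\min\bigl(S_n+V^x_{T_n-},\,1\bigr)\quad (n\ge 1).$$ Then for all $G\in\mathcal G$ and $\lambda>0$ this Markov process on $[0,1]$ has exactly one invariant probability distribution $\pi=\pi_{G,\lambda}$, and with $$d(t)=d_{G,\lambda}(t)=\sup_{x\in[0,1]}\ \sup_{A\text{ Borel}}\bigl|\mathbb P(V^x_t\in A)-\pi(A)\bigr|,\qquad \rho(G,\lambda)=\limsup_{t\to\infty} d(t)^{1/t},$$ there is no positive lower bound for the spectral gap $1-\rho(G,\lambda)$ that is uniform in $G$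 and $\lambda$: $$\inf_{G\in\mathcal G,\ \lambda>0}\bigl(1-\rho(G,\lambda)\bigr)=0.$$ -/

import Mathlib

open MeasureTheory ProbabilityTheory Filter Set

noncomputable section

namespace TruncatedQueue

/-- A realisation of the primitives: the `n`-th entry is the pair consisting of the `(n+1)`-st
inter-arrival time and the `(n+1)`-st service requirement. -/
abbrev Path : Type := ℕ → ℝ × ℝ

/-- The arrival times: `arrival ω 0 = 0`, and `arrival ω n` is the time at which the `n`-th
customer arrives. -/
def arrival (ω : Path) (n : ℕ) : ℝ := ∑ i ∈ Finset.range n, (ω i).1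

/-- The workload immediately after the `n`-th arrival, for the initial workload `x`. Between
arrivals the workload decreases at unit rate until it reaches `0`; at an arrival the service
requirement is added and the result is truncated at the capacity `1`. -/
def postArrival (ω : Path) (x : ℝ) : ℕ → ℝ
  | 0 => x
  | n + 1 => min ((ω n).2 + max (postArrival ω x n - (ω n).1) 0) 1

/-- The number of arrivals in `(0, t]`, i.e. the `n` with
`arrival ω n ≤ t < arrival ω (n + 1)`. -/
def numArrivals (ω : Path) (t : ℝ) : ℕ := sInf {n | t < arrival ω (n + 1)}

/-- The workload at time `t` for the initial workload `x`. -/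
def workload (ω : Path) (x t : ℝ) : ℝ :=
  max (postArrival ω x (numArrivals ω t) - (t - arrival ω (numArrivals ω t))) 0

/-- The law of the primitives: inter-arrival times and service requirements form two independent
i.i.d. sequences, the former exponential with rate `lam`, the latter with distribution `G`. -/
def pathLaw (lam : ℝ) (G : Measure ℝ) : Measure Path :=
  Measure.infinitePi fun _ : ℕ => (expMeasure lam).prod G

/-- The law of the workload at time `t` for the initial workload `x`. -/
def workloadLaw (lam : ℝ) (G : Measure ℝ) (t x : ℝ) : Measure ℝ :=
  (pathLaw lam G).map fun ω => workload ω x t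

/-- `G` is a probability distribution on `(0, ∞)`. -/
def IsServiceDistribution (G : Measure ℝ) : Prop :=
  IsProbabilityMeasure G ∧ G (Iic 0) = 0

/-- `π` is an invariant probability distribution, on the state space `[0, 1]`, of the workload
process. -/
def IsInvariantDistribution (lam : ℝ) (G π : Measure ℝ) : Prop :=
  IsProbabilityMeasure π ∧ π (Icc 0 1)ᶜ = 0 ∧
    ∀ t : ℝ, 0 ≤ t → ∀ A : Set ℝ, MeasurableSet A →
      ∫⁻ x, workloadLaw lam G t x A ∂π = π A

/-- The total variation distance `sup_A |μ A - ν A|` over Borel sets `A`. -/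
def tvDist (μ ν : Measure ℝ) : ℝ :=
  ⨆ A : {A : Set ℝ // MeasurableSet A}, |μ.real A - ν.real A|

/-- The worst-case distance `d(t)` to `π` at time `t`, over all initial workloads in `[0, 1]`. -/
def maxDist (lam : ℝ) (G π : Measure ℝ) (t : ℝ) : ℝ :=
  ⨆ x : Icc (0 : ℝ) 1, tvDist (workloadLaw lam G t x) π

/-- The rate `ρ = limsup_{t → ∞} d(t)^{1/t}`. -/
def convergenceRate (lam : ℝ) (G π : Measure ℝ) : ℝ :=
  limsup (fun t : ℝ => maxDist lam G π t ^ (1 / t)) atTop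

theorem measurable_arrival (n : ℕ) : Measurable fun ω : Path => arrival ω n := by
  unfold arrival
  fun_prop

theorem measurable_postArrival (n : ℕ) :
    Measurable fun p : Path × ℝ => postArrival p.1 p.2 n := by
  induction n with
  | zero => simpa only [postArrival] using measurable_snd
  | succ n ih =>
    simp only [postArrival]
    have h : Measurable fun p : Path × ℝ => p.1 n := (measurable_pi_apply n).comp measurable_fst
    exact (h.snd.add ((ih.sub h.fst).max measurable_const)).min measurable_const

theorem measurable_numArrivals (t : ℝ) : Measurable fun ω : Path => numArrivals ω t := by
  classical
  have hs (n : ℕ) : MeasurableSet {ω : Path | t < arrival ω (n + 1)} :=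
    measurableSet_lt measurable_const (measurable_arrival (n + 1))
  refine measurable_to_nat fun ω₀ => ?_
  generalize numArrivals ω₀ t = k
  have key : (fun ω : Path => numArrivals ω t) ⁻¹' {k} =
      {ω | (t < arrival ω (k + 1) ∧ ∀ m < k, ¬ t < arrival ω (m + 1)) ∨
        (k = 0 ∧ ∀ m, ¬ t < arrival ω (m + 1))} := by
    ext ω
    simp only [mem_preimage, mem_singleton_iff, mem_ofPred_eq, numArrivals]
    constructor
    · rintro rfl
      by_cases h : {n | t < arrival ω (n + 1)}.Nonempty
      · exact Or.inl ⟨Nat.sInf_mem h, fun m hm hm' => Nat.notMem_of_lt_sInf hm hm'⟩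
      · rw [not_nonempty_iff_eq_empty] at h
        refine Or.inr ⟨by rw [h, Nat.sInf_empty], fun m hm => ?_⟩
        exact (h ▸ hm : m ∈ (∅ : Set ℕ))
    · rintro (⟨h1, h2⟩ | ⟨rfl, h⟩)
      · refine le_antisymm (Nat.sInf_le h1) ?_
        by_contra! hlt
        exact h2 _ hlt (Nat.sInf_mem (s := {n | t < arrival ω (n + 1)}) ⟨k, h1⟩)
      · have : {n | t < arrival ω (n + 1)} = ∅ := eq_empty_of_forall_notMem h
        rw [this, Nat.sInf_empty]
  rw [key]
  have hall (p : ℕ → Prop) :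
      MeasurableSet {ω : Path | ∀ m, p m → ¬ t < arrival ω (m + 1)} := by
    have : {ω : Path | ∀ m, p m → ¬ t < arrival ω (m + 1)} =
        ⋂ m, ⋂ _ : p m, {ω : Path | t < arrival ω (m + 1)}ᶜ := by
      ext ω
      simp
    rw [this]
    exact MeasurableSet.iInter fun m => MeasurableSet.iInter fun _ => (hs m).compl
  refine MeasurableSet.union ((hs k).inter (hall fun m => m < k))
    ((MeasurableSet.const _).inter ?_)
  have h := hall fun _ => True
  simp only [true_imp_iff] at h
  exact h

/-- The workload at a fixed time is jointly measurable in the primitives and the initial value, so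
that `workloadLaw` is a genuine push-forward. -/
theorem measurable_workload (t : ℝ) : Measurable fun p : Path × ℝ => workload p.1 p.2 t := by
  have h : Measurable fun q : (Path × ℝ) × ℕ =>
      max (postArrival q.1.1 q.1.2 q.2 - (t - arrival q.1.1 q.2)) 0 :=
    measurable_from_prod_countable_left fun n =>
      ((measurable_postArrival n).sub
        (measurable_const.sub ((measurable_arrival n).comp measurable_fst))).max measurable_const
  exact h.comp (measurable_id.prodMk ((measurable_numArrivals t).comp measurable_fst))

end TruncatedQueue

end

noncomputable section

namespace TruncatedQueue

/-! ### The exponential distribution -/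

/-! A uniform gap already fails for exponential service. Let `G` have rate `mu`. If `lam = mu +
gam`, `mu * gam = w ^ 2` and `-w * sin w = gam * cos w`, then `cos (w x)` is an eigenfunction of the
generator with eigenvalue `-gam`: its slope vanishes at the idle state `0`, and the last relation
absorbs the truncation at `1`. Hence the mean of `cos (w V_t)` from `x` is `exp (-gam t) cos (w x)`
(`meanAt_cos`). Starting from `0` and from `1` these means differ by at least `exp (-gam t)` when
`cos w ≤ 0`, so `d(t) ≥ exp (-gam t) / 4` and the rate is at least `exp (-gam)`. The boundary
relation gives `gam = -w tan w`, which tends to `0` as `w` increases to `π`. Since the rate never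
exceeds `1`, the infimum is `0`.

The eigenfunction relation is proved without generators. Conditioning on the first arrival gives a
renewal equation (`meanAt_eq`) whose bounded solution is unique (`meanAt_eq_of_renewal`), so it
suffices to check that the proposed mean solves it. The same uniqueness yields Chapman–Kolmogorov
(`meanAt_add`).

For the invariant law, an arrival-free unit of time empties the system from every initial workload.
This is Doeblin's condition at time `1`, and it gives exactly one law invariant at time `1`
(`existsUnique_bind_transition_one`); the semigroup property extends invariance to all times. -/

theorem setIntegral_expMeasure {r : ℝ} (hr : 0 < r) {s : Set ℝ} (hs : MeasurableSet s)
    (h0 : s ⊆ Ici 0) (g : ℝ → ℝ) :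
    ∫ x in s, g x ∂expMeasure r = ∫ x in s, r * Real.exp (-(r * x)) * g x := by
  have h : expMeasure r = volume.withDensity (exponentialPDF r) := rfl
  rw [h, setIntegral_withDensity_eq_setIntegral_toReal_smul
    (f := exponentialPDF r) (measurable_exponentialPDFReal r).ennreal_ofReal
    (ae_of_all _ fun _ => ENNReal.ofReal_lt_top) _ hs]
  refine setIntegral_congr_fun hs fun x hx => ?_
  have hx' : 0 ≤ x := h0 hx
  simp only [exponentialPDF_of_nonneg hx', smul_eq_mul]
  rw [ENNReal.toReal_ofReal (by positivity)]

theorem expMeasure_real_Iic {r : ℝ} (hr : 0 < r) {t : ℝ} (ht : 0 ≤ t) :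
    (expMeasure r).real (Iic t) = 1 - Real.exp (-(r * t)) := by
  have := isProbabilityMeasure_expMeasure hr
  rw [← cdf_eq_real, cdf_expMeasure_eq hr, if_pos ht]

theorem expMeasure_Iic_zero {r : ℝ} (hr : 0 < r) : expMeasure r (Iic 0) = 0 := by
  have := isProbabilityMeasure_expMeasure hr
  have h := expMeasure_real_Iic hr le_rfl
  simp only [mul_zero, neg_zero, Real.exp_zero, sub_self] at h
  exact (measureReal_eq_zero_iff).1 h

theorem ae_expMeasure_pos {r : ℝ} (hr : 0 < r) : ∀ᵐ x ∂expMeasure r, 0 < x := by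
  rw [ae_iff]
  convert! expMeasure_Iic_zero hr using 2
  ext x; simp

theorem integral_expMeasure {r : ℝ} (hr : 0 < r) (g : ℝ → ℝ) :
    ∫ x, g x ∂expMeasure r = ∫ x in Ioi 0, r * Real.exp (-(r * x)) * g x := by
  rw [← setIntegral_expMeasure hr measurableSet_Ioi Ioi_subset_Ici_self]
  refine (setIntegral_eq_integral_of_ae_compl_eq_zero ?_).symm
  filter_upwards [ae_expMeasure_pos hr] with x hx hnot using absurd hx hnot

/-- The memoryless property. -/
theorem setIntegral_Ioi_expMeasure_comp_sub {r : ℝ} (hr : 0 < r) {t : ℝ} (ht : 0 ≤ t)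
    (h : ℝ → ℝ) :
    ∫ x in Ioi t, h (x - t) ∂expMeasure r = Real.exp (-(r * t)) * ∫ x, h x ∂expMeasure r := by
  rw [setIntegral_expMeasure hr measurableSet_Ioi (fun x hx => ht.trans (le_of_lt hx)),
    integral_expMeasure hr, ← integral_const_mul, ← integral_indicator measurableSet_Ioi,
    ← integral_indicator measurableSet_Ioi, ← integral_add_right_eq_self _ t]
  refine integral_congr_ae (ae_of_all _ fun x => ?_)
  by_cases hx : 0 < x
  · rw [indicator_of_mem (show x ∈ Ioi 0 from hx)]
    beta_reduce
    rw [indicator_of_mem (show x + t ∈ Ioi t by simpa using hx),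
      add_sub_cancel_right, mul_add, neg_add, Real.exp_add]
    ring
  · rw [indicator_of_notMem (show x ∉ Ioi 0 from hx)]
    beta_reduce
    rw [indicator_of_notMem (show x + t ∉ Ioi t by simpa using hx)]

/-- If `k` solves `k' = r (k - g)`, then `k 0` is the mean of `g` under the exponential
distribution with rate `r`. -/
theorem integral_expMeasure_eq_of_hasDerivAt {r : ℝ} (hr : 0 < r) {k g : ℝ → ℝ} {s : Set ℝ}
    (hs : s.Countable) (hk : Continuous k) {B : ℝ} (hkB : ∀ x, 0 ≤ x → |k x| ≤ B)
    (hg : Measurable g) {C : ℝ}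
    (hgC : ∀ x, 0 < x → |g x| ≤ C)
    (hd : ∀ x, 0 < x → x ∉ s → HasDerivAt k (r * (k x - g x)) x) :
    ∫ x, g x ∂expMeasure r = k 0 := by
  rw [integral_expMeasure hr]
  -- The equation for `k` makes `F` an antiderivative of the density times `g`; its boundary term at
  -- infinity vanishes because `k` is bounded.
  set F : ℝ → ℝ := fun x => -(Real.exp (-(r * x)) * k x) with hF
  have hint : IntegrableOn (fun x => r * Real.exp (-(r * x)) * g x) (Ioi 0) := by
    have h1 : IntegrableOn (fun x => r * Real.exp (-(r * x))) (Ioi 0) := by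
      have := exp_neg_integrableOn_Ioi 0 hr
      simp only [neg_mul] at this
      exact this.const_mul r
    exact Integrable.mul_bdd (c := C) h1 hg.aestronglyMeasurable
      (ae_restrict_of_forall_mem measurableSet_Ioi hgC)
  have hlim := intervalIntegral_tendsto_integral_Ioi 0 hint tendsto_id
  refine tendsto_nhds_unique hlim ?_
  have hexp : Tendsto (fun x => Real.exp (-(r * x))) atTop (nhds 0) := by
    refine Real.tendsto_exp_atBot.comp ?_
    exact tendsto_neg_atTop_atBot.comp (tendsto_id.const_mul_atTop hr)
  have hzero : Tendsto F atTop (nhds 0) := by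
    refine squeeze_zero_norm' (a := fun x => Real.exp (-(r * x)) * B) ?_ ?_
    · filter_upwards [eventually_ge_atTop 0] with x hx
      simp only [hF, norm_neg, norm_mul, Real.norm_eq_abs, Real.abs_exp]
      exact mul_le_mul_of_nonneg_left (hkB x hx) (Real.exp_pos _).le
    · simpa using hexp.mul_const B
  have hF0 : F 0 = -k 0 := by simp [hF]
  have : Tendsto (fun b => F b - F 0) atTop (nhds (k 0)) := by
    simpa [hF0] using hzero.sub_const (F 0)
  refine this.congr' ?_
  filter_upwards [eventually_ge_atTop 0] with b hb
  refine (integral_eq_of_hasDerivAt_off_countable_of_le F _ hb hs ?_ ?_ ?_).symm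
  · exact Continuous.continuousOn (by fun_prop)
  · rintro x ⟨hx, hxs⟩
    have h1 : HasDerivAt (fun x => Real.exp (-(r * x))) (Real.exp (-(r * x)) * -(r * 1)) x :=
      (((hasDerivAt_id x).const_mul r).neg).exp
    convert! (h1.mul (hd x hx.1 hxs)).neg using 1
    ring
  · rw [intervalIntegrable_iff_integrableOn_Ioc_of_le hb]
    exact hint.mono_set Ioc_subset_Ioi_self

/-! ### The first arrival -/

/-- The path whose first entry is `p.1`, followed by `p.2`. -/
def cons (p : (ℝ × ℝ) × Path) : Path
  | 0 => p.1
  | n + 1 => p.2 n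

/-- The workload just after an arrival, where `p` is the inter-arrival time and the service
requirement, and `x` is the workload just after the previous arrival. -/
def jump (x : ℝ) (p : ℝ × ℝ) : ℝ := min (p.2 + max (x - p.1) 0) 1

theorem arrival_cons_succ (p : ℝ × ℝ) (ω : Path) (n : ℕ) :
    arrival (cons (p, ω)) (n + 1) = arrival ω n + p.1 := by
  simp [arrival, Finset.sum_range_succ', cons]

theorem postArrival_cons_succ (p : ℝ × ℝ) (ω : Path) (x : ℝ) (n : ℕ) :
    postArrival (cons (p, ω)) x (n + 1) = postArrival ω (jump x p) n := by
  induction n with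
  | zero => rfl
  | succ n ih => rw [postArrival, ih]; rfl

theorem numArrivals_cons_of_lt {p : ℝ × ℝ} {t : ℝ} (h : t < p.1) (ω : Path) :
    numArrivals (cons (p, ω)) t = 0 :=
  Nat.sInf_eq_zero.2 (Or.inl (by simpa [arrival, cons] using h))

/-- The existence hypothesis matters: without a later arrival both infima are over the empty set,
hence `0`, and the shift by one fails. -/
theorem numArrivals_cons_of_le {p : ℝ × ℝ} {t : ℝ} (h : p.1 ≤ t) {ω : Path}
    (hω : ∃ n, t - p.1 < arrival ω (n + 1)) :
    numArrivals (cons (p, ω)) t = numArrivals ω (t - p.1) + 1 := by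
  have hmem : t - p.1 < arrival ω (numArrivals ω (t - p.1) + 1) :=
    Nat.sInf_mem (s := {n | t - p.1 < arrival ω (n + 1)}) hω
  have hS : numArrivals ω (t - p.1) + 1 ∈ {n | t < arrival (cons (p, ω)) (n + 1)} := by
    simp only [mem_ofPred_eq, arrival_cons_succ]; linarith
  refine le_antisymm (Nat.sInf_le hS) (le_csInf ⟨_, hS⟩ fun n hn => ?_)
  simp only [mem_ofPred_eq, arrival_cons_succ] at hn
  cases n with
  | zero => simp [arrival] at hn; linarith
  | succ n =>
    refine Nat.succ_le_succ (Nat.sInf_le ?_)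
    simp only [mem_ofPred_eq]; linarith

theorem workload_cons {p : ℝ × ℝ} {t : ℝ} {ω : Path} (x : ℝ)
    (hω : ∃ n, t - p.1 < arrival ω (n + 1)) :
    workload (cons (p, ω)) x t =
      if t < p.1 then max (x - t) 0 else workload ω (jump x p) (t - p.1) := by
  split_ifs with h
  · rw [workload, numArrivals_cons_of_lt h]
    simp [postArrival, arrival]
  · rw [workload, numArrivals_cons_of_le (not_lt.1 h) hω, postArrival_cons_succ,
      arrival_cons_succ, workload]
    congr 2
    ring

theorem measurable_cons : Measurable cons := by
  refine measurable_pi_iff.2 fun n => ?_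
  cases n with
  | zero => exact measurable_fst
  | succ n => exact (measurable_pi_apply n).comp measurable_snd

theorem measurable_jump : Measurable fun q : ℝ × (ℝ × ℝ) => jump q.1 q.2 := by
  unfold jump; fun_prop

theorem jump_mem {x : ℝ} {p : ℝ × ℝ} (hp : 0 < p.2) : jump x p ∈ Icc (0 : ℝ) 1 :=
  ⟨le_min (add_nonneg hp.le (le_max_right _ _)) zero_le_one, min_le_right _ _⟩

/-- The law of an inter-arrival time and an independent service requirement. -/
def stepLaw (lam : ℝ) (G : Measure ℝ) : Measure (ℝ × ℝ) := (expMeasure lam).prod G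

section

variable {lam : ℝ} {G : Measure ℝ}

theorem isProbabilityMeasure_stepLaw (hlam : 0 < lam) [IsProbabilityMeasure G] :
    IsProbabilityMeasure (stepLaw lam G) := by
  have := isProbabilityMeasure_expMeasure hlam
  unfold stepLaw; infer_instance

theorem isProbabilityMeasure_pathLaw (hlam : 0 < lam) [IsProbabilityMeasure G] :
    IsProbabilityMeasure (pathLaw lam G) := by
  have := isProbabilityMeasure_expMeasure hlam
  unfold pathLaw; infer_instance

/-- Prepending an independent step to an i.i.d. sequence does not change its law. On finite
cylinders the factor of coordinate `0` splits off from the product. -/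
theorem map_cons_pathLaw (hlam : 0 < lam) [IsProbabilityMeasure G] :
    ((stepLaw lam G).prod (pathLaw lam G)).map cons = pathLaw lam G := by
  have := isProbabilityMeasure_expMeasure hlam
  have := isProbabilityMeasure_stepLaw hlam (G := G)
  have := isProbabilityMeasure_pathLaw hlam (G := G)
  refine Measure.eq_infinitePi _ fun s t ht => ?_
  classical
  rw [Measure.map_apply measurable_cons
    (MeasurableSet.pi s.countable_toSet fun i _ => ht i)]
  have hpre : cons ⁻¹' (Set.pi s t) =
      (if 0 ∈ s then t 0 else univ) ×ˢ
        (Set.pi (s.preimage Nat.succ Nat.succ_injective.injOn) fun n => t (n + 1)) := by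
    ext ⟨p, ω⟩
    simp only [mem_preimage, Set.mem_pi, mem_prod, Finset.mem_coe, Finset.mem_preimage]
    constructor
    · intro h
      refine ⟨?_, fun n hn => h (n + 1) hn⟩
      split_ifs with h0
      · exact h 0 h0
      · trivial
    · rintro ⟨h0, h1⟩ n hn
      cases n with
      | zero => simpa [hn, cons] using h0
      | succ n => exact h1 n hn
  rw [hpre, Measure.prod_prod, pathLaw, Measure.infinitePi_pi _ fun i _ => ht (i + 1)]
  have hprod : ∏ i ∈ s.preimage Nat.succ Nat.succ_injective.injOn,
      (expMeasure lam).prod G (t (i + 1)) = ∏ i ∈ s.erase 0, (expMeasure lam).prod G (t i) := by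
    rw [← Finset.prod_image (s := s.preimage Nat.succ Nat.succ_injective.injOn) (g := Nat.succ)
      (f := fun i => (expMeasure lam).prod G (t i)) Nat.succ_injective.injOn]
    congr 1
    ext n
    cases n with
    | zero => simp
    | succ n => simp
  rw [hprod]
  split_ifs with h0
  · exact Finset.mul_prod_erase s (fun i => (expMeasure lam).prod G (t i)) h0
  · rw [measure_univ, one_mul, Finset.erase_eq_of_notMem h0]

theorem ae_pathLaw_pos (hlam : 0 < lam) [IsProbabilityMeasure G] :
    ∀ᵐ ω ∂pathLaw lam G, ∀ n, 0 < (ω n).1 := by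
  have := isProbabilityMeasure_expMeasure hlam
  refine ae_all_iff.2 fun n => ?_
  have h : ∀ᵐ p ∂(expMeasure lam).prod G, 0 < p.1 :=
    Measure.quasiMeasurePreserving_fst.ae (ae_expMeasure_pos hlam)
  exact (measurePreserving_eval_infinitePi (fun _ : ℕ => (expMeasure lam).prod G)
    n).quasiMeasurePreserving.ae h

theorem stepLaw_real_le (hlam : 0 < lam) [IsProbabilityMeasure G] {t : ℝ} (ht : 0 ≤ t) :
    (stepLaw lam G).real {p | p.1 ≤ t} = 1 - Real.exp (-(lam * t)) := by
  have := isProbabilityMeasure_expMeasure hlam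
  have h : {p : ℝ × ℝ | p.1 ≤ t} = Iic t ×ˢ univ := by ext; simp
  rw [h, stepLaw, measureReal_prod_prod, expMeasure_real_Iic hlam ht, probReal_univ, mul_one]

/-- One gap longer than `N` is enough. The event that all gaps are at most `N` has probability at
most `a ^ n` for every `n`, with a fixed `a < 1`. -/
theorem ae_exists_lt_arrival (hlam : 0 < lam) [IsProbabilityMeasure G] :
    ∀ᵐ ω ∂pathLaw lam G, ∀ t, ∃ n, t < arrival ω (n + 1) := by
  have := isProbabilityMeasure_expMeasure hlam
  have := isProbabilityMeasure_stepLaw hlam (G := G)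
  have hgap (N : ℕ) : ∀ᵐ ω ∂pathLaw lam G, ∃ n, (N : ℝ) < (ω n).1 := by
    rw [ae_iff]
    have hset : {ω : Path | ¬ ∃ n, (N : ℝ) < (ω n).1} =
        Set.pi univ fun _ => {p : ℝ × ℝ | p.1 ≤ N} := by
      ext ω; simp
    have hm : MeasurableSet {p : ℝ × ℝ | p.1 ≤ N} :=
      measurableSet_le measurable_fst measurable_const
    have hlt : stepLaw lam G {p | p.1 ≤ N} < 1 := by
      rw [← ENNReal.toReal_lt_toReal (measure_ne_top _ _) ENNReal.one_ne_top, ENNReal.toReal_one]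
      have := stepLaw_real_le hlam (G := G) (Nat.cast_nonneg (α := ℝ) N)
      rw [measureReal_def] at this
      rw [this]
      linarith [Real.exp_pos (-(lam * N))]
    rw [hset]
    refine le_antisymm (ge_of_tendsto' (ENNReal.tendsto_pow_atTop_nhds_zero_of_lt_one hlt)
      fun n => ?_) zero_le
    calc pathLaw lam G (Set.pi univ fun _ => {p : ℝ × ℝ | p.1 ≤ N})
        ≤ pathLaw lam G (Set.pi (Finset.range n) fun _ => {p : ℝ × ℝ | p.1 ≤ N}) :=
          measure_mono (Set.pi_mono' (fun _ _ => subset_rfl) (subset_univ _))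
      _ = stepLaw lam G {p | p.1 ≤ N} ^ n := by
          rw [pathLaw, Measure.infinitePi_pi _ fun _ _ => hm]
          simp [stepLaw]
  filter_upwards [ae_all_iff.2 hgap, ae_pathLaw_pos hlam (G := G)] with ω hω hpos t
  obtain ⟨N, hN⟩ := exists_nat_gt t
  obtain ⟨n, hn⟩ := hω N
  refine ⟨n, hN.trans (hn.trans_le ?_)⟩
  exact Finset.single_le_sum (f := fun i => (ω i).1) (fun i _ => (hpos i).le)
    (Finset.mem_range.2 n.lt_succ_self)

end

/-! ### Joint measurability -/

theorem measurable_numArrivals_prod : Measurable fun q : Path × ℝ => numArrivals q.1 q.2 := by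
  -- Subtracting `t` from the first gap turns time `t` into time `0`, so measurability at a fixed
  -- time suffices.
  let shift : Path × ℝ → Path := fun q => cons (((q.1 0).1 - q.2, (q.1 0).2), fun n => q.1 (n + 1))
  have hshift : Measurable shift := by
    refine measurable_cons.comp (Measurable.prodMk ?_ ?_) <;> fun_prop
  have heq (q : Path × ℝ) : numArrivals q.1 q.2 = numArrivals (shift q) 0 := by
    simp only [numArrivals, shift, arrival_cons_succ]
    congr 1
    ext n
    simp only [arrival, mem_ofPred_eq, Finset.sum_range_succ' _ n]
    constructor <;> intro h <;> linarith
  simp only [heq]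
  exact (measurable_numArrivals 0).comp hshift

theorem measurable_workload_prod :
    Measurable fun q : Path × ℝ × ℝ => workload q.1 q.2.2 q.2.1 := by
  have h : Measurable fun q : (Path × ℝ × ℝ) × ℕ =>
      max (postArrival q.1.1 q.1.2.2 q.2 - (q.1.2.1 - arrival q.1.1 q.2)) 0 :=
    measurable_from_prod_countable_left fun n =>
      (((measurable_postArrival n).comp (measurable_fst.prodMk measurable_snd.snd)).sub
        (measurable_snd.fst.sub ((measurable_arrival n).comp measurable_fst))).max measurable_const
  exact h.comp (measurable_id.prodMk
    (measurable_numArrivals_prod.comp (measurable_fst.prodMk measurable_snd.fst)))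

/-! ### The renewal equation -/

/-- The mean of `f` at time `t` for the initial workload `x`. -/
def meanAt (lam : ℝ) (G : Measure ℝ) (t : ℝ) (f : ℝ → ℝ) (x : ℝ) : ℝ :=
  ∫ ω, f (workload ω x t) ∂pathLaw lam G

section

variable {lam : ℝ} {G : Measure ℝ} {f : ℝ → ℝ} {C : ℝ}

theorem meanAt_eq_integral_workloadLaw (hf : Measurable f) (t x : ℝ) :
    meanAt lam G t f x = ∫ y, f y ∂workloadLaw lam G t x := by
  have h : Measurable fun ω => workload ω x t :=
    (measurable_workload t).comp (measurable_id.prodMk measurable_const)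
  rw [workloadLaw, integral_map h.aemeasurable hf.aestronglyMeasurable, meanAt]

theorem measurable_meanAt (hlam : 0 < lam) [IsProbabilityMeasure G] (hf : Measurable f) :
    Measurable fun q : ℝ × ℝ => meanAt lam G q.1 f q.2 := by
  have := isProbabilityMeasure_pathLaw hlam (G := G)
  have h : StronglyMeasurable fun q : (ℝ × ℝ) × Path => f (workload q.2 q.1.2 q.1.1) :=
    (hf.comp (measurable_workload_prod.comp
      (measurable_snd.prodMk measurable_fst))).stronglyMeasurable
  exact h.integral_prod_right.measurable

theorem abs_meanAt_le (hlam : 0 < lam) [IsProbabilityMeasure G] (hC : ∀ x, |f x| ≤ C) (t x : ℝ) :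
    |meanAt lam G t f x| ≤ C := by
  have := isProbabilityMeasure_pathLaw hlam (G := G)
  have h := norm_integral_le_of_norm_le_const (μ := pathLaw lam G) (C := C)
    (f := fun ω => f (workload ω x t)) (ae_of_all _ fun ω => hC (workload ω x t))
  simpa [meanAt] using h

/-- Condition on the first gap and service: past the first arrival the remaining path has the
original law and starts from the post-arrival workload. -/
theorem meanAt_eq (hlam : 0 < lam) [IsProbabilityMeasure G] (hf : Measurable f)
    (hC : ∀ x, |f x| ≤ C) (t x : ℝ) :
    meanAt lam G t f x = ∫ p, (if t < p.1 then f (max (x - t) 0)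
      else meanAt lam G (t - p.1) f (jump x p)) ∂stepLaw lam G := by
  have := isProbabilityMeasure_stepLaw hlam (G := G)
  have := isProbabilityMeasure_pathLaw hlam (G := G)
  have hm : Measurable fun ω => f (workload ω x t) :=
    hf.comp ((measurable_workload t).comp (measurable_id.prodMk measurable_const))
  conv_lhs => rw [meanAt, ← map_cons_pathLaw hlam]
  rw [integral_map measurable_cons.aemeasurable hm.aestronglyMeasurable,
    integral_prod (fun q => f (workload (cons q) x t))
      (Integrable.of_bound (hm.comp measurable_cons).aestronglyMeasurable C
        (ae_of_all _ fun q => hC _))]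
  refine integral_congr_ae (ae_of_all _ fun p => ?_)
  have h : ∀ᵐ ω ∂pathLaw lam G, f (workload (cons (p, ω)) x t) =
      if t < p.1 then f (max (x - t) 0) else f (workload ω (jump x p) (t - p.1)) := by
    filter_upwards [ae_exists_lt_arrival hlam (G := G)] with ω hω
    rw [workload_cons x (hω _)]
    split_ifs <;> rfl
  beta_reduce
  rw [integral_congr_ae h]
  split_ifs
  · simp
  · rfl

theorem ae_stepLaw_pos (hlam : 0 < lam) (hG : IsServiceDistribution G) :
    ∀ᵐ p ∂stepLaw lam G, 0 < p.1 ∧ 0 < p.2 := by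
  have := isProbabilityMeasure_expMeasure hlam
  have := hG.1
  have h1 : ∀ᵐ p ∂stepLaw lam G, 0 < p.1 :=
    Measure.quasiMeasurePreserving_fst.ae (ae_expMeasure_pos hlam)
  have h2 : ∀ᵐ p ∂stepLaw lam G, 0 < p.2 := by
    refine Measure.quasiMeasurePreserving_snd.ae ?_
    rw [ae_iff]
    convert! hG.2 using 2
    ext x; simp
  exact h1.and h2

theorem measurable_renewal {u : ℝ → ℝ → ℝ} (hu : Measurable fun q : ℝ × ℝ => u q.1 q.2)
    (t x a : ℝ) :
    Measurable fun p : ℝ × ℝ => if t < p.1 then a else u (t - p.1) (jump x p) := by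
  have h : Measurable fun p : ℝ × ℝ => (t - p.1, jump x p) :=
    (measurable_const.sub measurable_fst).prodMk
      (measurable_jump.comp (measurable_const.prodMk measurable_id))
  have h' : Measurable fun p : ℝ × ℝ => u (t - p.1) (jump x p) := hu.comp h
  exact Measurable.ite (measurableSet_lt measurable_const measurable_fst) measurable_const h'

theorem integrable_renewal (hlam : 0 < lam) [IsProbabilityMeasure G] {u : ℝ → ℝ → ℝ}
    (hu : Measurable fun q : ℝ × ℝ => u q.1 q.2) {B : ℝ} (huB : ∀ t x, 0 ≤ t → |u t x| ≤ B)
    (t x a : ℝ) :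
    Integrable (fun p : ℝ × ℝ => if t < p.1 then a else u (t - p.1) (jump x p))
      (stepLaw lam G) := by
  have := isProbabilityMeasure_stepLaw hlam (G := G)
  refine Integrable.of_bound (C := max |a| B) (measurable_renewal hu t x a).aestronglyMeasurable
    (ae_of_all _ fun p => ?_)
  split_ifs with h
  · exact le_max_left _ _
  · exact (huB _ _ (sub_nonneg.2 (not_lt.1 h))).trans (le_max_right _ _)

/-- A bounded solution of the renewal equation with initial value `f` is the mean of `f`. -/
theorem meanAt_eq_of_renewal (hlam : 0 < lam) (hG : IsServiceDistribution G) (hf : Measurable f)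
    (hC : ∀ x, |f x| ≤ C) {u : ℝ → ℝ → ℝ} (hu : Measurable fun q : ℝ × ℝ => u q.1 q.2) {B : ℝ}
    (huB : ∀ t x, 0 ≤ t → |u t x| ≤ B)
    (hur : ∀ t x, 0 ≤ t → x ∈ Icc (0 : ℝ) 1 → u t x =
      ∫ p, (if t < p.1 then f (max (x - t) 0) else u (t - p.1) (jump x p)) ∂stepLaw lam G)
    {T : ℝ} (hT : 0 ≤ T) {x : ℝ} (hx : x ∈ Icc (0 : ℝ) 1) : meanAt lam G T f x = u T x := by
  have := hG.1
  have := isProbabilityMeasure_stepLaw hlam (G := G)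
  -- `q` is the probability of an arrival by time `T`, the contraction factor of the renewal
  -- operator on `[0, T]`.
  set q := 1 - Real.exp (-(lam * T)) with hq
  have hq0 : 0 ≤ q := by
    rw [hq, sub_nonneg, Real.exp_le_one_iff]
    have := mul_nonneg hlam.le hT
    linarith
  have hq1 : q < 1 := by linarith [Real.exp_pos (-(lam * T))]
  have key (n : ℕ) : ∀ t x, t ∈ Icc 0 T → x ∈ Icc (0 : ℝ) 1 →
      |meanAt lam G t f x - u t x| ≤ q ^ n * (C + B) := by
    induction n with
    | zero =>
      intro t x ht _
      rw [pow_zero, one_mul]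
      exact (abs_sub _ _).trans (add_le_add (abs_meanAt_le hlam hC t x) (huB t x ht.1))
    | succ n ih =>
      intro t x ht hx
      have hCB : 0 ≤ q ^ n * (C + B) := (abs_nonneg _).trans (ih t x ht hx)
      rw [meanAt_eq hlam hf hC, hur t x ht.1 hx, ← integral_sub
        (integrable_renewal hlam (measurable_meanAt hlam hf)
          (fun t x _ => abs_meanAt_le hlam hC t x) _ _ _)
        (integrable_renewal hlam hu huB _ _ _)]
      have hms : MeasurableSet {p : ℝ × ℝ | p.1 ≤ T} :=
        measurableSet_le measurable_fst measurable_const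
      rw [← Real.norm_eq_abs]
      -- The two integrands agree when the first arrival comes after `t`, so only first arrivals up
      -- to `T` contribute.
      calc _ ≤ ∫ p, {p : ℝ × ℝ | p.1 ≤ T}.indicator (fun _ => q ^ n * (C + B)) p
            ∂stepLaw lam G := by
            refine norm_integral_le_of_norm_le
              ((integrable_const (q ^ n * (C + B))).indicator hms) ?_
            filter_upwards [ae_stepLaw_pos hlam hG] with p hp
            split_ifs with h
            · simpa using indicator_nonneg (fun _ _ => hCB) p
            · rw [not_lt] at h
              rw [indicator_of_mem (show p ∈ {p : ℝ × ℝ | p.1 ≤ T} from h.trans ht.2)]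
              exact ih _ _ ⟨sub_nonneg.2 h, by linarith [ht.2, hp.1]⟩ (jump_mem hp.2)
        _ = q ^ (n + 1) * (C + B) := by
            rw [integral_indicator_const _ hms, stepLaw_real_le hlam hT, smul_eq_mul]
            ring
  have hlim : Tendsto (fun n : ℕ => q ^ n * (C + B)) atTop (nhds 0) := by
    simpa using (tendsto_pow_atTop_nhds_zero_of_lt_one hq0 hq1).mul_const (C + B)
  have h := ge_of_tendsto' hlim fun n => key n T x ⟨hT, le_rfl⟩ hx
  exact sub_eq_zero.1 (abs_nonpos_iff.1 h)

theorem max_max_sub_zero (a : ℝ) {b : ℝ} (hb : 0 ≤ b) : max (max a 0 - b) 0 = max (a - b) 0 := by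
  rcases le_total a 0 with h | h
  · rw [max_eq_right h, max_eq_right (by linarith), max_eq_right (by linarith)]
  · rw [max_eq_left h]

theorem setIntegral_stepLaw_comp_sub (hlam : 0 < lam) [IsProbabilityMeasure G] {H : ℝ × ℝ → ℝ}
    (hH : Measurable H) {B : ℝ} (hB : ∀ p, |H p| ≤ B) {t : ℝ} (ht : 0 ≤ t) :
    ∫ p in {p | t < p.1}, H (p.1 - t, p.2) ∂stepLaw lam G =
      Real.exp (-(lam * t)) * ∫ p, H p ∂stepLaw lam G := by
  have := isProbabilityMeasure_expMeasure hlam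
  have hset : {p : ℝ × ℝ | t < p.1} = Ioi t ×ˢ univ := by ext; simp
  rw [hset, stepLaw, setIntegral_prod (fun p : ℝ × ℝ => H (p.1 - t, p.2)),
    integral_prod _ (Integrable.of_bound hH.aestronglyMeasurable B (ae_of_all _ hB)),
    ← setIntegral_Ioi_expMeasure_comp_sub hlam ht]
  · simp
  · have hm : Measurable fun p : ℝ × ℝ => H (p.1 - t, p.2) := hH.comp (by fun_prop)
    exact (Integrable.of_bound hm.aestronglyMeasurable B (ae_of_all _ fun p => hB _)).integrableOn

/-- The Chapman–Kolmogorov equation. -/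
theorem meanAt_add (hlam : 0 < lam) (hG : IsServiceDistribution G) (hf : Measurable f)
    (hC : ∀ x, |f x| ≤ C) {s t : ℝ} (hs : 0 ≤ s) (ht : 0 ≤ t) {x : ℝ} (hx : x ∈ Icc (0 : ℝ) 1) :
    meanAt lam G t (meanAt lam G s f) x = meanAt lam G (t + s) f x := by
  have := hG.1
  have := isProbabilityMeasure_expMeasure hlam
  have := isProbabilityMeasure_stepLaw hlam (G := G)
  have hmeas := measurable_meanAt hlam (G := G) hf
  have hbd := fun t x => abs_meanAt_le hlam (G := G) hC t x
  have hms : Measurable (meanAt lam G s f) := hmeas.comp (measurable_const.prodMk measurable_id)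
  -- As a function of `t`, the mean at time `t + s` should solve the renewal equation with initial
  -- value `meanAt lam G s f`. The integrals are split according to whether the first arrival comes
  -- after `t`; on that event memorylessness restarts the clock.
  refine meanAt_eq_of_renewal hlam hG hms
    (hbd s) (u := fun t x => meanAt lam G (t + s) f x)
    (hmeas.comp ((measurable_fst.add_const s).prodMk measurable_snd))
    (fun t x _ => hbd (t + s) x) ?_ ht hx
  clear ht hx t x
  intro t x ht hx
  have hS : MeasurableSet {p : ℝ × ℝ | t < p.1} := measurableSet_lt measurable_const measurable_fst
  -- after time `t` without arrivals the process starts afresh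
  set H : ℝ × ℝ → ℝ := fun p => if s < p.1 then f (max (max (x - t) 0 - s) 0)
    else meanAt lam G (s - p.1) f (jump (max (x - t) 0) p) with hH
  have hHm : Measurable H := measurable_renewal (u := fun t x => meanAt lam G t f x)
    hmeas s _ _
  have hHC (p : ℝ × ℝ) : |H p| ≤ C := by
    simp only [hH]
    split_ifs
    exacts [hC _, hbd _ _]
  have hpos : EqOn (fun p : ℝ × ℝ => if t + s < p.1 then f (max (x - (t + s)) 0)
      else meanAt lam G (t + s - p.1) f (jump x p)) (fun p => H (p.1 - t, p.2))
      {p | t < p.1} := by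
    intro p h
    have h' : t < p.1 := h
    have e1 : max (max (x - t) 0 - s) 0 = max (x - (t + s)) 0 := by
      rw [max_max_sub_zero _ hs]; ring_nf
    have e2 : jump (max (x - t) 0) (p.1 - t, p.2) = jump x p := by
      simp only [jump]
      rw [max_max_sub_zero _ (by linarith)]; ring_nf
    have e3 : s - (p.1 - t) = t + s - p.1 := by ring
    have e4 : s < p.1 - t ↔ t + s < p.1 := by constructor <;> intro h <;> linarith
    simp only [hH, e1, e2, e3, e4]
  have hneg : EqOn (fun p : ℝ × ℝ => if t + s < p.1 then f (max (x - (t + s)) 0)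
      else meanAt lam G (t + s - p.1) f (jump x p))
      (fun p => if t < p.1 then meanAt lam G s f (max (x - t) 0)
      else meanAt lam G (t - p.1 + s) f (jump x p)) {p | t < p.1}ᶜ := by
    intro p h
    have h' : p.1 ≤ t := not_lt.1 h
    have e : t - p.1 + s = t + s - p.1 := by ring
    simp only [e]
    rw [if_neg (by linarith), if_neg (by linarith)]
  have hconst : EqOn (fun p : ℝ × ℝ => if t < p.1 then meanAt lam G s f (max (x - t) 0)
      else meanAt lam G (t - p.1 + s) f (jump x p))
      (fun _ => meanAt lam G s f (max (x - t) 0)) {p | t < p.1} := fun p h => if_pos h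
  have hreal : (stepLaw lam G).real {p | t < p.1} = Real.exp (-(lam * t)) := by
    have h : {p : ℝ × ℝ | t < p.1} = {p | p.1 ≤ t}ᶜ := by ext; simp
    rw [h, probReal_compl_eq_one_sub (measurableSet_le measurable_fst measurable_const),
      stepLaw_real_le hlam ht, sub_sub_cancel]
  rw [meanAt_eq hlam hf hC, ← integral_add_compl hS
      (integrable_renewal hlam hmeas (fun t x _ => hbd t x) _ _ _),
    setIntegral_congr_fun hS hpos, setIntegral_congr_fun hS.compl hneg,
    setIntegral_stepLaw_comp_sub hlam hHm hHC ht, ← meanAt_eq hlam hf hC,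
    ← integral_add_compl hS (integrable_renewal hlam
      (u := fun t x => meanAt lam G (t + s) f x)
      (hmeas.comp ((measurable_fst.add_const s).prodMk measurable_snd))
      (fun t x _ => hbd (t + s) x) _ _ _),
    setIntegral_congr_fun hS hconst, setIntegral_const, hreal, smul_eq_mul]

end

/-! ### Minorization -/

section Minorization

variable {α : Type*} [MeasurableSpace α]

theorem bind_add_measure (μ ν : Measure α) {R : α → Measure α} (hR : Measurable R) :
    (μ + ν).bind R = μ.bind R + ν.bind R := by
  ext A hA
  rw [Measure.add_apply, Measure.bind_apply hA hR.aemeasurable,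
    Measure.bind_apply hA hR.aemeasurable, Measure.bind_apply hA hR.aemeasurable,
    lintegral_add_measure]

/-- The measures `ν, νR, νR², …`. -/
def iterBind (ν : Measure α) (R : α → Measure α) : ℕ → Measure α
  | 0 => ν
  | n + 1 => (iterBind ν R n).bind R

theorem iterBind_univ (ν : Measure α) [IsProbabilityMeasure ν] {R : α → Measure α}
    (hR : Measurable R) {q : ENNReal} (hq : ∀ x, R x univ = q) (n : ℕ) :
    iterBind ν R n univ = q ^ n := by
  induction n with
  | zero => simp [iterBind]
  | succ n ih =>
    rw [iterBind, Measure.bind_apply MeasurableSet.univ hR.aemeasurable]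
    simp [hq, ih, pow_succ, mul_comm]

theorem bind_eq_of_minorization {κ R : α → Measure α} (hR : Measurable R) {c : ENNReal}
    {ν : Measure α} (hκR : ∀ x, κ x = c • ν + R x) (π : Measure α) [IsProbabilityMeasure π] :
    π.bind κ = c • ν + π.bind R := by
  have hκ : Measurable κ := by
    rw [funext hκR]
    exact measurable_const.add hR
  ext A hA
  rw [Measure.bind_apply hA hκ.aemeasurable, Measure.add_apply,
    Measure.bind_apply hA hR.aemeasurable]
  simp only [hκR, Measure.add_apply]
  rw [lintegral_add_left measurable_const, lintegral_const, measure_univ, mul_one]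

/-- A Markov kernel that dominates a fixed positive multiple of a probability measure has exactly
one invariant probability measure. -/
theorem existsUnique_invariant_of_minorization {κ R : α → Measure α} (hR : Measurable R)
    {c : ENNReal} (hc : c ≠ 0) {ν : Measure α} [IsProbabilityMeasure ν]
    (hκR : ∀ x, κ x = c • ν + R x) {q : ENNReal} (hq : ∀ x, R x univ = q) (hcq : c + q = 1) :
    ∃! π : Measure α, IsProbabilityMeasure π ∧ π.bind κ = π := by
  have hq1 : q ≠ ⊤ := fun h => by simp [h] at hcq
  have hc1 : 1 - q = c := ENNReal.sub_eq_of_eq_add hq1 hcq.symm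
  have hctop : c ≠ ⊤ := fun h => by simp [h] at hcq
  -- The equation `π = c • ν + π.bind R` is solved by its Neumann series, of total mass `c / (1 - q)
  -- = 1`.
  set π : Measure α := Measure.sum fun n => c • iterBind ν R n with hπ
  have hπ1 : IsProbabilityMeasure π := by
    refine ⟨?_⟩
    rw [hπ, Measure.sum_apply _ MeasurableSet.univ]
    simp only [Measure.smul_apply, iterBind_univ ν hR hq, smul_eq_mul]
    rw [ENNReal.tsum_mul_left, ENNReal.tsum_geometric, hc1, ENNReal.mul_inv_cancel hc hctop]
  refine ⟨π, ⟨hπ1, ?_⟩, ?_⟩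
  · rw [bind_eq_of_minorization hR hκR]
    conv_lhs => rw [hπ, Measure.bind_sum _ _ hR.aemeasurable]
    ext A hA
    rw [Measure.add_apply, hπ, Measure.sum_apply _ hA, Measure.sum_apply _ hA,
      tsum_eq_zero_add' (f := fun n => (c • iterBind ν R n) A) ENNReal.summable]
    refine congrArg₂ (· + ·) rfl (tsum_congr fun n => ?_)
    rw [Measure.bind_smul]
    rfl
  · rintro π' ⟨hπ', hinv⟩
    have h0 : π' = c • ν + π'.bind R := by
      conv_lhs => rw [← hinv]
      exact bind_eq_of_minorization hR hκR π'
    have hstep (n : ℕ) : iterBind π' R n = c • iterBind ν R n + iterBind π' R (n + 1) := by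
      induction n with
      | zero => exact h0
      | succ n ih =>
        conv_lhs => rw [iterBind, ih, bind_add_measure _ _ hR, Measure.bind_smul]
        rfl
    -- Iterating the fixed-point equation shows that any invariant `π'` dominates every partial sum
    -- of the series, hence `π`; both have mass one, so they agree.
    have hpart (n : ℕ) : π' = ∑ i ∈ Finset.range n, c • iterBind ν R i + iterBind π' R n := by
      induction n with
      | zero => simp [iterBind]
      | succ n ih => rw [Finset.sum_range_succ, add_assoc, ← hstep n]; exact ih
    refine (Measure.eq_of_le_of_isProbabilityMeasure (Measure.le_intro fun A hA _ => ?_)).symm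
    rw [hπ, Measure.sum_apply _ hA]
    refine ENNReal.tsum_le_of_sum_range_le fun n => ?_
    conv_rhs => rw [hpart n]
    rw [Measure.add_apply, Measure.finsetSum_apply]
    exact le_self_add

end Minorization

/-! ### The invariant distribution -/

theorem postArrival_le_one (ω : Path) {x : ℝ} (hx : x ≤ 1) (n : ℕ) : postArrival ω x n ≤ 1 := by
  cases n with
  | zero => exact hx
  | succ n => exact min_le_right _ _

theorem arrival_numArrivals_le (ω : Path) {t : ℝ} (ht : 0 ≤ t) :
    arrival ω (numArrivals ω t) ≤ t := by
  rcases h : numArrivals ω t with _ | n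
  · simpa [arrival] using ht
  · by_contra! hlt
    have : numArrivals ω t ≤ n := Nat.sInf_le hlt
    omega

theorem workload_mem (ω : Path) {x t : ℝ} (hx : x ≤ 1) (ht : 0 ≤ t) :
    workload ω x t ∈ Icc (0 : ℝ) 1 := by
  refine ⟨le_max_right _ _, max_le ?_ zero_le_one⟩
  linarith [postArrival_le_one ω hx (numArrivals ω t), arrival_numArrivals_le ω ht]

theorem workload_eq_of_lt {ω : Path} {t : ℝ} (h : t < (ω 0).1) (x : ℝ) :
    workload ω x t = max (x - t) 0 := by
  have : numArrivals ω t = 0 := Nat.sInf_eq_zero.2 (Or.inl (by simpa [arrival] using h))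
  simp [workload, this, postArrival, arrival]

/-- The point of `[0, 1]` closest to `x`. -/
def clamp (x : ℝ) : ℝ := min (max x 0) 1

theorem measurable_clamp : Measurable clamp := by
  unfold clamp; fun_prop

theorem clamp_mem (x : ℝ) : clamp x ∈ Icc (0 : ℝ) 1 :=
  ⟨le_min (le_max_right _ _) zero_le_one, min_le_right _ _⟩

theorem clamp_of_mem {x : ℝ} (hx : x ∈ Icc (0 : ℝ) 1) : clamp x = x := by
  rw [clamp, max_eq_left hx.1, min_eq_left hx.2]

/-- The law of the workload at time `t`, extended to all initial values. -/
def transition (lam : ℝ) (G : Measure ℝ) (t x : ℝ) : Measure ℝ := workloadLaw lam G t (clamp x)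

theorem measurable_workload_left (x t : ℝ) : Measurable fun ω => workload ω x t :=
  (measurable_workload t).comp (measurable_id.prodMk measurable_const)

/-- The measure `P` is general so that the restriction of `pathLaw` to paths with an early arrival,
which is the residual part in `transition_one_eq`, is covered too. Clamping lets that decomposition
hold at every real `x`. -/
theorem measurable_map_workload (P : Measure Path) [SFinite P] (t : ℝ) :
    Measurable fun x => P.map fun ω => workload ω (clamp x) t := by
  refine Measure.measurable_of_measurable_coe _ fun A hA => ?_
  have h : MeasurableSet {q : ℝ × Path | workload q.2 (clamp q.1) t ∈ A} :=
    ((measurable_workload t).comp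
      (measurable_snd.prodMk (measurable_clamp.comp measurable_fst))) hA
  simp only [Measure.map_apply (measurable_workload_left _ _) hA]
  exact measurable_measure_prodMk_left (ν := P) h

section

variable {lam : ℝ} {G : Measure ℝ}

theorem isProbabilityMeasure_workloadLaw (hlam : 0 < lam) [IsProbabilityMeasure G] (t x : ℝ) :
    IsProbabilityMeasure (workloadLaw lam G t x) := by
  have := isProbabilityMeasure_pathLaw hlam (G := G)
  exact Measure.isProbabilityMeasure_map (measurable_workload_left _ _).aemeasurable

theorem measurable_transition (hlam : 0 < lam) [IsProbabilityMeasure G] (t : ℝ) :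
    Measurable (transition lam G t) := by
  have := isProbabilityMeasure_pathLaw hlam (G := G)
  exact measurable_map_workload _ t

theorem ae_workloadLaw_mem {t x : ℝ} (ht : 0 ≤ t)
    (hx : x ≤ 1) : ∀ᵐ y ∂workloadLaw lam G t x, y ∈ Icc (0 : ℝ) 1 :=
  (ae_map_iff (measurable_workload_left _ _).aemeasurable measurableSet_Icc).2
    (ae_of_all _ fun ω => workload_mem ω hx ht)

theorem workloadLaw_real_eq_meanAt {A : Set ℝ} (hA : MeasurableSet A) (t x : ℝ) :
    (workloadLaw lam G t x).real A = meanAt lam G t (A.indicator 1) x := by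
  rw [meanAt_eq_integral_workloadLaw (measurable_one.indicator hA), integral_indicator_one hA]

theorem transition_bind (hlam : 0 < lam) (hG : IsServiceDistribution G) {s t : ℝ} (hs : 0 ≤ s)
    (ht : 0 ≤ t) (x : ℝ) :
    (transition lam G t x).bind (transition lam G s) = transition lam G (t + s) x := by
  have := hG.1
  have hp (t x : ℝ) := isProbabilityMeasure_workloadLaw hlam (G := G) t x
  ext A hA
  rw [Measure.bind_apply hA (measurable_transition hlam s).aemeasurable]
  have hmf : Measurable (A.indicator (1 : ℝ → ℝ)) := measurable_one.indicator hA
  have hC (y : ℝ) : |A.indicator (1 : ℝ → ℝ) y| ≤ 1 := by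
    by_cases hy : y ∈ A <;> simp [hy]
  have hm : Measurable (meanAt lam G s (A.indicator 1)) :=
    (measurable_meanAt hlam hmf).comp (measurable_const.prodMk measurable_id)
  have h1 : ∀ᵐ y ∂transition lam G t x, transition lam G s y A =
      ENNReal.ofReal (meanAt lam G s (A.indicator 1) y) := by
    filter_upwards [ae_workloadLaw_mem ht (clamp_mem x).2] with y hy
    rw [transition, clamp_of_mem hy, ← workloadLaw_real_eq_meanAt hA, ofReal_measureReal]
  have hnn (y : ℝ) : 0 ≤ meanAt lam G s (A.indicator 1) y := by
    rw [← workloadLaw_real_eq_meanAt hA]; exact measureReal_nonneg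
  rw [lintegral_congr_ae h1, transition, ← ofReal_integral_eq_lintegral_ofReal
    (Integrable.of_bound hm.aestronglyMeasurable 1
      (ae_of_all _ fun y => abs_meanAt_le hlam hC s y)) (ae_of_all _ hnn),
    ← meanAt_eq_integral_workloadLaw hm, meanAt_add hlam hG hmf hC hs ht (clamp_mem x),
    ← workloadLaw_real_eq_meanAt hA, ofReal_measureReal, transition]

/-- If nobody arrives during a unit of time, then the workload at its end is `0`. -/
theorem transition_one_eq (x : ℝ) :
    transition lam G 1 x = pathLaw lam G {ω | 1 < (ω 0).1} • Measure.dirac 0 +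
      ((pathLaw lam G).restrict {ω | 1 < (ω 0).1}ᶜ).map fun ω => workload ω (clamp x) 1 := by
  have hS : MeasurableSet {ω : Path | 1 < (ω 0).1} :=
    measurableSet_lt measurable_const (measurable_pi_apply 0).fst
  conv_lhs => rw [transition, workloadLaw, ← Measure.restrict_add_restrict_compl hS
    (μ := pathLaw lam G), Measure.map_add _ _ (measurable_workload_left _ _)]
  congr 1
  have h : (fun ω => workload ω (clamp x) 1) =ᵐ[(pathLaw lam G).restrict {ω | 1 < (ω 0).1}]
      fun _ => 0 := by
    filter_upwards [ae_restrict_mem hS] with ω hω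
    rw [workload_eq_of_lt hω, max_eq_right (by linarith [(clamp_mem x).2])]
  rw [Measure.map_congr h, Measure.map_const, Measure.restrict_apply_univ]

theorem pathLaw_lt_pos (hlam : 0 < lam) [IsProbabilityMeasure G] :
    pathLaw lam G {ω | 1 < (ω 0).1} ≠ 0 := by
  have := isProbabilityMeasure_expMeasure hlam
  have := isProbabilityMeasure_stepLaw hlam (G := G)
  have hS : MeasurableSet {p : ℝ × ℝ | p.1 ≤ 1} := measurableSet_le measurable_fst measurable_const
  have h1 : pathLaw lam G {ω | 1 < (ω 0).1} = stepLaw lam G {p | p.1 ≤ 1}ᶜ := by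
    rw [← (measurePreserving_eval_infinitePi (fun _ : ℕ => stepLaw lam G) 0).measure_preimage
      hS.compl.nullMeasurableSet]
    simp only [pathLaw, stepLaw]
    congr 1
    ext ω; simp
  rw [h1, ← measureReal_ne_zero_iff, probReal_compl_eq_one_sub hS, stepLaw_real_le hlam zero_le_one,
    sub_sub_cancel]
  exact (Real.exp_pos _).ne'

theorem existsUnique_bind_transition_one (hlam : 0 < lam) [IsProbabilityMeasure G] :
    ∃! π : Measure ℝ, IsProbabilityMeasure π ∧ π.bind (transition lam G 1) = π := by
  have := isProbabilityMeasure_pathLaw hlam (G := G)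
  have hS : MeasurableSet {ω : Path | 1 < (ω 0).1} :=
    measurableSet_lt measurable_const (measurable_pi_apply 0).fst
  refine existsUnique_invariant_of_minorization (measurable_map_workload _ 1)
    (pathLaw_lt_pos hlam) transition_one_eq (q := pathLaw lam G {ω | 1 < (ω 0).1}ᶜ)
    (fun x => ?_) (prob_add_prob_compl hS)
  rw [Measure.map_apply (measurable_workload_left _ _) MeasurableSet.univ, preimage_univ,
    Measure.restrict_apply_univ]

theorem IsInvariantDistribution.ae_mem {π : Measure ℝ} (h : IsInvariantDistribution lam G π) :
    ∀ᵐ x ∂π, x ∈ Icc (0 : ℝ) 1 := h.2.1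

theorem IsInvariantDistribution.bind_transition (hlam : 0 < lam) [IsProbabilityMeasure G]
    {π : Measure ℝ} (h : IsInvariantDistribution lam G π) {t : ℝ} (ht : 0 ≤ t) :
    π.bind (transition lam G t) = π := by
  ext A hA
  rw [Measure.bind_apply hA (measurable_transition hlam t).aemeasurable, ← h.2.2 t ht A hA]
  refine lintegral_congr_ae ?_
  filter_upwards [h.ae_mem] with x hx
  rw [transition, clamp_of_mem hx]

theorem existsUnique_isInvariantDistribution (hG : IsServiceDistribution G) (hlam : 0 < lam) :
    ∃! π : Measure ℝ, IsInvariantDistribution lam G π := by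
  have := hG.1
  have hp (t x : ℝ) := isProbabilityMeasure_workloadLaw hlam (G := G) t x
  have hmeas := measurable_transition hlam (G := G)
  obtain ⟨π, ⟨hπ, hinv⟩, huniq⟩ := existsUnique_bind_transition_one hlam (G := G)
  -- The kernels at times `t` and `1` commute, so `π.bind (transition lam G t)` is again invariant
  -- at time `1` and equals `π` by uniqueness.
  have hbind (t : ℝ) (ht : 0 ≤ t) : π.bind (transition lam G t) = π := by
    refine huniq _ ⟨?_, ?_⟩
    · refine ⟨?_⟩
      rw [Measure.bind_apply MeasurableSet.univ (hmeas t).aemeasurable]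
      simp [transition]
    · have h1 : (π.bind (transition lam G t)).bind (transition lam G 1) =
          (π.bind (transition lam G 1)).bind (transition lam G t) := by
        rw [Measure.bind_bind (hmeas t).aemeasurable (hmeas 1).aemeasurable,
          Measure.bind_bind (hmeas 1).aemeasurable (hmeas t).aemeasurable]
        simp only [transition_bind hlam hG zero_le_one ht, transition_bind hlam hG ht zero_le_one,
          add_comm]
      rw [h1, hinv]
  have hsupp : π (Icc 0 1)ᶜ = 0 := by
    rw [← hinv, Measure.bind_apply measurableSet_Icc.compl (hmeas 1).aemeasurable]
    refine (lintegral_congr fun x => ?_).trans lintegral_zero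
    exact ae_workloadLaw_mem zero_le_one (clamp_mem x).2
  refine ⟨π, ⟨hπ, hsupp, fun t ht A hA => ?_⟩, fun π' hπ' => ?_⟩
  · conv_rhs => rw [← hbind t ht, Measure.bind_apply hA (hmeas t).aemeasurable]
    refine lintegral_congr_ae ?_
    filter_upwards [show ∀ᵐ x ∂π, x ∈ Icc (0 : ℝ) 1 from hsupp] with x hx
    rw [transition, clamp_of_mem hx]
  · exact huniq _ ⟨hπ'.1, hπ'.bind_transition hlam zero_le_one⟩

end

/-! ### Total variation distance -/

section TotalVariation

theorem tvDist_nonneg {μ ν : Measure ℝ} : 0 ≤ tvDist μ ν :=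
  Real.iSup_nonneg fun _ => abs_nonneg _

theorem integral_eq_setIntegral_measureReal_lt {μ : Measure ℝ} [IsProbabilityMeasure μ]
    {g : ℝ → ℝ} (hg : Measurable g) {B : ℝ}
    (h0 : ∀ x, 0 ≤ g x) (hB : ∀ x, g x ≤ B) :
    ∫ x, g x ∂μ = ∫ s in Ioc 0 B, μ.real {x | s < g x} := by
  have hint : Integrable g μ := Integrable.of_bound hg.aestronglyMeasurable B
    (ae_of_all _ fun x => by rw [Real.norm_eq_abs, abs_of_nonneg (h0 x)]; exact hB x)
  rw [hint.integral_eq_integral_meas_lt (ae_of_all _ h0)]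
  refine setIntegral_eq_of_subset_of_forall_sdiff_eq_zero measurableSet_Ioi
    Ioc_subset_Ioi_self ?_
  rintro s ⟨hs, hs'⟩
  have hBs : B < s := by
    by_contra! h
    exact hs' ⟨hs, h⟩
  have : {x | s < g x} = ∅ := by
    ext x
    simpa using (hB x).trans hBs.le
  rw [this, measureReal_empty]

theorem integrableOn_measureReal_lt (μ : Measure ℝ) [IsProbabilityMeasure μ] (g : ℝ → ℝ) (B : ℝ) :
    IntegrableOn (fun s => μ.real {x | s < g x}) (Ioc 0 B) := by
  have hanti : Antitone fun s => μ.real {x | s < g x} := fun s t hst =>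
    measureReal_mono (fun x hx => lt_of_le_of_lt hst hx)
  refine Integrable.of_bound hanti.measurable.aestronglyMeasurable 1 (ae_of_all _ fun s => ?_)
  rw [Real.norm_eq_abs, abs_of_nonneg measureReal_nonneg]
  exact measureReal_le_one

variable {μ ν : Measure ℝ} [IsProbabilityMeasure μ] [IsProbabilityMeasure ν]

theorem abs_measureReal_sub_le_one (A : Set ℝ) : |μ.real A - ν.real A| ≤ 1 := by
  have h1 : μ.real A ≤ 1 := measureReal_le_one
  have h2 : ν.real A ≤ 1 := measureReal_le_one
  have h3 : 0 ≤ μ.real A := measureReal_nonneg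
  have h4 : 0 ≤ ν.real A := measureReal_nonneg
  rw [abs_le]
  constructor <;> linarith

theorem abs_measureReal_sub_le_tvDist {A : Set ℝ} (hA : MeasurableSet A) :
    |μ.real A - ν.real A| ≤ tvDist μ ν :=
  le_ciSup (f := fun A : {A : Set ℝ // MeasurableSet A} => |μ.real A - ν.real A|)
    ⟨1, by rintro _ ⟨A, rfl⟩; exact abs_measureReal_sub_le_one _⟩ ⟨A, hA⟩

theorem tvDist_le_one : tvDist μ ν ≤ 1 :=
  have : Nonempty {A : Set ℝ // MeasurableSet A} := ⟨∅, MeasurableSet.empty⟩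
  ciSup_le fun _ => abs_measureReal_sub_le_one _

/-- By the layer-cake formula the integral of `f + 1`, with values in `[0, 2]`, is an integral over
levels of measures of superlevel sets. The factor `2` is the length of the range of levels. -/
theorem integral_sub_le_tvDist {f : ℝ → ℝ} (hf : Measurable f) (hf1 : ∀ x, |f x| ≤ 1) :
    |∫ x, f x ∂μ - ∫ x, f x ∂ν| ≤ 2 * tvDist μ ν := by
  have hint (ρ : Measure ℝ) [IsProbabilityMeasure ρ] : Integrable f ρ :=
    Integrable.of_bound hf.aestronglyMeasurable 1 (ae_of_all _ hf1)
  have hg0 (x : ℝ) : 0 ≤ f x + 1 := by linarith [(abs_le.1 (hf1 x)).1]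
  have hg2 (x : ℝ) : f x + 1 ≤ 2 := by linarith [(abs_le.1 (hf1 x)).2]
  have hgm : Measurable fun x => f x + 1 := hf.add_const 1
  have hshift (ρ : Measure ℝ) [IsProbabilityMeasure ρ] :
      ∫ x, f x ∂ρ = (∫ s in Ioc 0 2, ρ.real {x | s < f x + 1}) - 1 := by
    rw [← integral_eq_setIntegral_measureReal_lt hgm hg0 hg2,
      integral_add (hint ρ) (integrable_const _)]
    simp
  rw [hshift μ, hshift ν, sub_sub_sub_cancel_right, ← integral_sub
    (integrableOn_measureReal_lt _ _ _) (integrableOn_measureReal_lt _ _ _)]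
  have h := norm_setIntegral_le_of_norm_le_const (μ := volume) (s := Ioc (0 : ℝ) 2)
    (f := fun s => μ.real {x | s < f x + 1} - ν.real {x | s < f x + 1}) (C := tvDist μ ν)
    (by simp) fun s _ => abs_measureReal_sub_le_tvDist (measurableSet_lt measurable_const hgm)
  simpa [mul_comm] using h

end TotalVariation

/-! ### The convergence rate -/

section

variable {lam : ℝ} {G π : Measure ℝ}

theorem maxDist_nonneg (t : ℝ) : 0 ≤ maxDist lam G π t :=
  Real.iSup_nonneg fun _ => tvDist_nonneg

theorem tvDist_le_maxDist (hlam : 0 < lam) [IsProbabilityMeasure G] [IsProbabilityMeasure π]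
    (t : ℝ) {x : ℝ} (hx : x ∈ Icc (0 : ℝ) 1) :
    tvDist (workloadLaw lam G t x) π ≤ maxDist lam G π t := by
  have hp (t x : ℝ) := isProbabilityMeasure_workloadLaw hlam (G := G) t x
  exact le_ciSup (f := fun x : Icc (0 : ℝ) 1 => tvDist (workloadLaw lam G t x) π)
    ⟨1, by rintro _ ⟨x, rfl⟩; exact tvDist_le_one⟩ ⟨x, hx⟩

theorem maxDist_le_one (hlam : 0 < lam) [IsProbabilityMeasure G] [IsProbabilityMeasure π]
    (t : ℝ) : maxDist lam G π t ≤ 1 := by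
  have hp (t x : ℝ) := isProbabilityMeasure_workloadLaw hlam (G := G) t x
  have : Nonempty (Icc (0 : ℝ) 1) := ⟨0, by simp⟩
  exact ciSup_le fun _ => tvDist_le_one

theorem eventually_maxDist_rpow_le_one (hlam : 0 < lam) [IsProbabilityMeasure G]
    [IsProbabilityMeasure π] : ∀ᶠ t in atTop, maxDist lam G π t ^ (1 / t) ≤ 1 := by
  filter_upwards [eventually_gt_atTop 0] with t ht
  exact Real.rpow_le_one (maxDist_nonneg t) (maxDist_le_one hlam t) (by positivity)

theorem convergenceRate_le_one (hlam : 0 < lam) [IsProbabilityMeasure G]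
    [IsProbabilityMeasure π] : convergenceRate lam G π ≤ 1 := by
  refine limsup_le_of_le ?_ (eventually_maxDist_rpow_le_one hlam)
  have h : IsBoundedUnder (· ≥ ·) atTop fun t : ℝ => maxDist lam G π t ^ (1 / t) :=
    ⟨0, eventually_map.2 (Eventually.of_forall fun t => Real.rpow_nonneg (maxDist_nonneg t) _)⟩
  exact h.isCoboundedUnder_le

theorem exp_neg_le_convergenceRate (hlam : 0 < lam) [IsProbabilityMeasure G]
    [IsProbabilityMeasure π] {c gam : ℝ} (hc : 0 < c)
    (h : ∀ t, 0 < t → c * Real.exp (-(gam * t)) ≤ maxDist lam G π t) :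
    Real.exp (-gam) ≤ convergenceRate lam G π := by
  refine le_limsup_of_le ⟨1, eventually_map.2 (eventually_maxDist_rpow_le_one hlam)⟩ fun b hb => ?_
  -- The constant `c` is harmless because `c ^ (1 / t)` tends to `1`.
  have hlim : Tendsto (fun t : ℝ => c ^ (1 / t) * Real.exp (-gam)) atTop
      (nhds (Real.exp (-gam))) := by
    have h0 : Tendsto (fun t : ℝ => 1 / t) atTop (nhds 0) := by
      simpa using tendsto_inv_atTop_zero (𝕜 := ℝ)
    have h1 := (Real.continuousAt_const_rpow (b := 0) hc.ne').tendsto.comp h0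
    simpa using h1.mul_const (Real.exp (-gam))
  refine le_of_tendsto hlim ?_
  filter_upwards [hb, eventually_gt_atTop 0] with t hbt ht
  refine le_trans ?_ hbt
  have h2 := Real.rpow_le_rpow (by positivity) (h t ht) (show 0 ≤ 1 / t by positivity)
  rwa [Real.mul_rpow hc.le (Real.exp_pos _).le, ← Real.exp_mul,
    show -(gam * t) * (1 / t) = -gam by field_simp] at h2

end

/-! ### An explicit eigenfunction for exponential service -/

section Eigenfunction

/-- The mean of `cos (w * ·)` just after an arrival that finds the workload `y`. -/
def cosAfterJump (w lam mu y : ℝ) : ℝ := (mu * Real.cos (w * y) - w * Real.sin (w * y)) / lam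

variable {w lam mu gam : ℝ}

theorem hasDerivAt_cosAfterJump (hlam : 0 < lam) (hsum : lam = mu + gam) (hprod : mu * gam = w ^ 2)
    (y : ℝ) : HasDerivAt (cosAfterJump w lam mu)
      (mu * (cosAfterJump w lam mu y - Real.cos (w * y))) y := by
  have hw : HasDerivAt (fun y => w * y) w y := by simpa using (hasDerivAt_id y).const_mul w
  have h := ((hw.cos.const_mul mu).sub (hw.sin.const_mul w)).div_const lam
  convert! h using 1
  unfold cosAfterJump
  field_simp
  rw [hsum]
  linear_combination (-Real.cos (w * y)) * hprod

theorem continuous_cosAfterJump : Continuous (cosAfterJump w lam mu) := by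
  unfold cosAfterJump; fun_prop

theorem abs_cosAfterJump_le (hlam : 0 < lam) (y : ℝ) :
    |cosAfterJump w lam mu y| ≤ (|mu| + |w|) / lam := by
  rw [cosAfterJump, abs_div, abs_of_pos hlam]
  gcongr
  refine (abs_sub _ _).trans (add_le_add ?_ ?_) <;> rw [abs_mul]
  · exact mul_le_of_le_one_right (abs_nonneg _) (Real.abs_cos_le_one _)
  · exact mul_le_of_le_one_right (abs_nonneg _) (Real.abs_sin_le_one _)

/-- For `s < 1 - y`, `hasDerivAt_cosAfterJump` is the equation required by
`integral_expMeasure_eq_of_hasDerivAt`. Beyond the truncation both functions are constant, and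
`hbdry` says exactly that these constants agree. -/
theorem integral_cos_jump (hlam : 0 < lam) (hmu : 0 < mu) (hsum : lam = mu + gam)
    (hprod : mu * gam = w ^ 2) (hbdry : -w * Real.sin w = gam * Real.cos w) {y : ℝ} (hy : y ≤ 1) :
    ∫ s, Real.cos (w * min (s + y) 1) ∂expMeasure mu = cosAfterJump w lam mu y := by
  have h1 : cosAfterJump w lam mu 1 = Real.cos w := by
    rw [cosAfterJump, mul_one, div_eq_iff hlam.ne', hsum]
    linear_combination hbdry
  have h := integral_expMeasure_eq_of_hasDerivAt hmu (s := {1 - y}) (countable_singleton _)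
    (k := fun s => cosAfterJump w lam mu (min (s + y) 1))
    (g := fun s => Real.cos (w * min (s + y) 1))
    (continuous_cosAfterJump.comp (by fun_prop)) (fun _ _ => abs_cosAfterJump_le hlam _)
    (by fun_prop) (fun _ _ => Real.abs_cos_le_one _) ?_
  · simpa [min_eq_left hy] using h
  · intro s _ hs
    rcases lt_or_gt_of_ne hs with hlt | hgt
    · have hev : (fun s => cosAfterJump w lam mu (min (s + y) 1)) =ᶠ[nhds s]
          fun s => cosAfterJump w lam mu (s + y) := by
        filter_upwards [eventually_lt_nhds hlt] with s' hs'
        rw [min_eq_left (by linarith)]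
      rw [min_eq_left (by linarith)]
      exact ((hasDerivAt_cosAfterJump hlam hsum hprod
        (s + y)).comp_add_const s y).congr_of_eventuallyEq hev
    · have hev : (fun s => cosAfterJump w lam mu (min (s + y) 1)) =ᶠ[nhds s]
          fun _ => cosAfterJump w lam mu 1 := by
        filter_upwards [eventually_gt_nhds hgt] with s' hs'
        rw [min_eq_right (by linarith)]
      rw [min_eq_right (by linarith), h1, mul_one, sub_self, mul_zero]
      exact (hasDerivAt_const s _).congr_of_eventuallyEq hev

/-- The renewal equation for the eigenfunction, with the service already averaged out. The function
`k` below is the candidate mean with time `min r t` elapsed; it solves the required equation while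
busy (`r < x`), while idle (`r > x`) and, being frozen, after `t`. The points `t` and `x`, where the
formulas change, are excluded. -/
theorem integral_cos_firstArrival (hlam : 0 < lam) (hsum : lam = mu + gam) (hgam : 0 ≤ gam)
    {t x : ℝ} (ht : 0 ≤ t) (hx : 0 ≤ x) :
    ∫ r, (if t < r then Real.cos (w * max (x - t) 0)
      else Real.exp (-(gam * (t - r))) * cosAfterJump w lam mu (max (x - r) 0)) ∂expMeasure lam =
      Real.exp (-(gam * t)) * Real.cos (w * x) := by
  have h := integral_expMeasure_eq_of_hasDerivAt hlam (s := {t, x}) (to_countable _)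
    (k := fun r => Real.exp (-(gam * (t - min r t))) * Real.cos (w * max (x - min r t) 0))
    (g := fun r => if t < r then Real.cos (w * max (x - t) 0)
      else Real.exp (-(gam * (t - r))) * cosAfterJump w lam mu (max (x - r) 0))
    (B := 1) (C := 1 + (|mu| + |w|) / lam) (by fun_prop) ?_ ?_ ?_ ?_
  · rw [h, min_eq_left ht, sub_zero, sub_zero, max_eq_left hx]
  · intro r _
    rw [abs_mul, Real.abs_exp]
    refine mul_le_one₀ (Real.exp_le_one_iff.2 ?_) (abs_nonneg _) (Real.abs_cos_le_one _)
    have := mul_nonneg hgam (sub_nonneg.2 (min_le_right r t))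
    linarith
  · refine Measurable.ite measurableSet_Ioi measurable_const (Measurable.mul (by fun_prop) ?_)
    exact continuous_cosAfterJump.measurable.comp (by fun_prop)
  · intro r _
    have hnn : 0 ≤ (|mu| + |w|) / lam := by positivity
    split_ifs with hr
    · linarith [Real.abs_cos_le_one (w * max (x - t) 0)]
    · rw [abs_mul, Real.abs_exp]
      have he : Real.exp (-(gam * (t - r))) ≤ 1 := by
        have := mul_nonneg hgam (sub_nonneg.2 (not_lt.1 hr))
        exact Real.exp_le_one_iff.2 (by linarith)
      have := mul_le_mul he (abs_cosAfterJump_le (w := w) (mu := mu) hlam (max (x - r) 0))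
        (abs_nonneg _) zero_le_one
      linarith
  · intro r _ hr
    simp only [mem_insert_iff, mem_singleton_iff, not_or] at hr
    rcases lt_or_gt_of_ne hr.1 with hrt | hrt
    · have hexp : HasDerivAt (fun r => Real.exp (-(gam * (t - r))))
          (Real.exp (-(gam * (t - r))) * gam) r := by
        simpa using ((((hasDerivAt_id r).const_sub t).const_mul gam).neg).exp
      rw [if_neg (not_lt.2 hrt.le), min_eq_left hrt.le]
      rcases lt_or_gt_of_ne hr.2 with hrx | hrx
      · have hev : (fun r => Real.exp (-(gam * (t - min r t))) *
            Real.cos (w * max (x - min r t) 0)) =ᶠ[nhds r]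
            fun r => Real.exp (-(gam * (t - r))) * Real.cos (w * (x - r)) := by
          filter_upwards [eventually_lt_nhds hrt, eventually_lt_nhds hrx] with r' h1 h2
          rw [min_eq_left h1.le, max_eq_left (by linarith)]
        have hcos : HasDerivAt (fun r => Real.cos (w * (x - r)))
            (-Real.sin (w * (x - r)) * (w * -1)) r :=
          (((hasDerivAt_id r).const_sub x).const_mul w).cos
        refine HasDerivAt.congr_of_eventuallyEq ?_ hev
        convert! hexp.mul hcos using 1
        rw [max_eq_left (by linarith), cosAfterJump]
        field_simp
        rw [hsum]
        ring
      · have hev : (fun r => Real.exp (-(gam * (t - min r t))) *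
            Real.cos (w * max (x - min r t) 0)) =ᶠ[nhds r]
            fun r => Real.exp (-(gam * (t - r))) := by
          filter_upwards [eventually_lt_nhds hrt, eventually_gt_nhds hrx] with r' h1 h2
          rw [min_eq_left h1.le, max_eq_right (by linarith), mul_zero, Real.cos_zero, mul_one]
        refine HasDerivAt.congr_of_eventuallyEq ?_ hev
        convert! hexp using 1
        rw [max_eq_right (by linarith), cosAfterJump, mul_zero, Real.cos_zero, Real.sin_zero]
        field_simp
        rw [hsum]
        ring
    · have hev : (fun r => Real.exp (-(gam * (t - min r t))) *
          Real.cos (w * max (x - min r t) 0)) =ᶠ[nhds r]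
          fun _ => Real.cos (w * max (x - t) 0) := by
        filter_upwards [eventually_gt_nhds hrt] with r' h1
        rw [min_eq_right h1.le, sub_self, mul_zero, neg_zero, Real.exp_zero, one_mul]
      rw [if_pos hrt, min_eq_right hrt.le, sub_self, mul_zero, neg_zero, Real.exp_zero, one_mul,
        sub_self, mul_zero]
      exact (hasDerivAt_const r _).congr_of_eventuallyEq hev

theorem isServiceDistribution_expMeasure (hmu : 0 < mu) :
    IsServiceDistribution (expMeasure mu) :=
  ⟨isProbabilityMeasure_expMeasure hmu, expMeasure_Iic_zero hmu⟩

theorem meanAt_cos (hlam : 0 < lam) (hmu : 0 < mu) (hgam : 0 ≤ gam) (hsum : lam = mu + gam)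
    (hprod : mu * gam = w ^ 2) (hbdry : -w * Real.sin w = gam * Real.cos w) {t x : ℝ}
    (ht : 0 ≤ t) (hx : x ∈ Icc (0 : ℝ) 1) :
    meanAt lam (expMeasure mu) t (fun y => Real.cos (w * y)) x =
      Real.exp (-(gam * t)) * Real.cos (w * x) := by
  have hG := isServiceDistribution_expMeasure hmu
  have := hG.1
  have := isProbabilityMeasure_expMeasure hlam
  have hum : Measurable fun q : ℝ × ℝ => Real.exp (-(gam * q.1)) * Real.cos (w * q.2) := by
    fun_prop
  have huB (t x : ℝ) (ht : 0 ≤ t) : |Real.exp (-(gam * t)) * Real.cos (w * x)| ≤ 1 := by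
    rw [abs_mul, Real.abs_exp]
    refine mul_le_one₀ (Real.exp_le_one_iff.2 ?_) (abs_nonneg _) (Real.abs_cos_le_one _)
    linarith [mul_nonneg hgam ht]
  refine meanAt_eq_of_renewal hlam hG (by fun_prop) (fun _ => Real.abs_cos_le_one _)
    (u := fun t x => Real.exp (-(gam * t)) * Real.cos (w * x)) hum huB ?_ ht hx
  clear ht hx t x
  intro t x ht hx
  have hint := integrable_renewal hlam (G := expMeasure mu)
    (u := fun t x => Real.exp (-(gam * t)) * Real.cos (w * x)) hum huB t x
    (Real.cos (w * max (x - t) 0))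
  rw [stepLaw] at hint ⊢
  rw [integral_prod _ hint, ← integral_cos_firstArrival hlam hsum hgam ht hx.1]
  refine integral_congr_ae ?_
  filter_upwards [ae_expMeasure_pos hlam] with r hr
  split_ifs with h
  · simp
  · rw [integral_const_mul]
    simp only [jump]
    rw [integral_cos_jump hlam hmu hsum hprod hbdry
      (max_le (by linarith [hx.2]) zero_le_one)]

theorem exp_neg_le_convergenceRate_expMeasure (hlam : 0 < lam) (hmu : 0 < mu) (hgam : 0 ≤ gam)
    (hsum : lam = mu + gam) (hprod : mu * gam = w ^ 2)
    (hbdry : -w * Real.sin w = gam * Real.cos w) (hcos : Real.cos w ≤ 0) {π : Measure ℝ}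
    [IsProbabilityMeasure π] :
    Real.exp (-gam) ≤ convergenceRate lam (expMeasure mu) π := by
  have := isProbabilityMeasure_expMeasure hmu
  have hp (t x : ℝ) := isProbabilityMeasure_workloadLaw hlam (G := expMeasure mu) t x
  -- Each of the means from `0` and `1` is within `2 * maxDist` of the mean under `π`, which cancels
  -- on subtraction. Their difference is at least `exp (-gam t)` because `cos w ≤ 0`, whence the
  -- constant `1 / 4`.
  refine exp_neg_le_convergenceRate hlam (c := 1 / 4) (by norm_num) fun t ht => ?_
  have hfm : Measurable fun y => Real.cos (w * y) := by fun_prop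
  have h0 : (0 : ℝ) ∈ Icc (0 : ℝ) 1 := by simp
  have h1 : (1 : ℝ) ∈ Icc (0 : ℝ) 1 := by simp
  have hx {x : ℝ} (hx : x ∈ Icc (0 : ℝ) 1) : |Real.exp (-(gam * t)) * Real.cos (w * x) -
      ∫ y, Real.cos (w * y) ∂π| ≤ 2 * maxDist lam (expMeasure mu) π t := by
    rw [← meanAt_cos hlam hmu hgam hsum hprod hbdry ht.le hx, meanAt_eq_integral_workloadLaw hfm]
    exact (integral_sub_le_tvDist hfm fun _ => Real.abs_cos_le_one _).trans
      (mul_le_mul_of_nonneg_left (tvDist_le_maxDist hlam t hx) zero_le_two)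
  have e0 := (abs_le.1 (hx h0)).2
  have e1 := (abs_le.1 (hx h1)).1
  rw [mul_zero, Real.cos_zero] at e0
  rw [mul_one] at e1
  have := mul_nonpos_of_nonneg_of_nonpos (Real.exp_pos (-(gam * t))).le hcos
  linarith

/-- The rate is not bounded away from `1`, even for exponential service. -/
theorem exists_lt_convergenceRate {ε : ℝ} (hε : 0 < ε) : ∃ lam mu : ℝ, 0 < lam ∧ 0 < mu ∧
    ∀ π : Measure ℝ, IsProbabilityMeasure π →
      1 - ε < convergenceRate lam (expMeasure mu) π := by
  have hlim : Tendsto (fun w => -w * Real.tan w) (nhds Real.pi) (nhds 0) := by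
    have hc : ContinuousAt (fun w => -w * Real.tan w) Real.pi :=
      continuousAt_id.neg.mul (Real.continuousAt_tan.2 (by simp))
    simpa [ContinuousAt] using hc
  -- Approaching `π` from below makes `sin w > 0 > cos w`, hence `gam = -w * tan w` positive and
  -- small; `mu = w ^ 2 / gam` is then forced.
  have hev : ∀ᶠ w in nhdsWithin Real.pi (Iio Real.pi),
      -w * Real.tan w < ε ∧ Real.pi / 2 < w ∧ w < Real.pi := by
    refine Eventually.and ((hlim.mono_left nhdsWithin_le_nhds).eventually (gt_mem_nhds hε)) ?_
    refine Eventually.and (nhdsWithin_le_nhds (lt_mem_nhds (by linarith [Real.pi_pos]))) ?_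
    exact self_mem_nhdsWithin
  obtain ⟨w, hwε, hw1, hw2⟩ := hev.exists
  have hw : 0 < w := by linarith [Real.pi_pos]
  have hsin : 0 < Real.sin w := Real.sin_pos_of_pos_of_lt_pi hw hw2
  have hcos : Real.cos w < 0 := Real.cos_neg_of_pi_div_two_lt_of_lt hw1 (by linarith [Real.pi_pos])
  have hgam : 0 < -w * Real.tan w := by
    rw [Real.tan_eq_sin_div_cos]
    exact mul_pos_of_neg_of_neg (by linarith) (div_neg_of_pos_of_neg hsin hcos)
  have hmu : 0 < w ^ 2 / (-w * Real.tan w) := by positivity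
  refine ⟨_, _, add_pos hmu hgam, hmu, fun π hπ => ?_⟩
  refine lt_of_lt_of_le ?_ (exp_neg_le_convergenceRate_expMeasure (w := w) (add_pos hmu hgam) hmu
    hgam.le rfl (div_mul_cancel₀ _ hgam.ne') ?_ hcos.le)
  · linarith [Real.one_sub_le_exp_neg (-w * Real.tan w)]
  · rw [mul_assoc, Real.tan_mul_cos hcos.ne]

end Eigenfunction

end TruncatedQueue

end

theorem theorem3 :
    (∀ (G : Measure ℝ) (lam : ℝ), TruncatedQueue.IsServiceDistribution G → 0 < lam →
      ∃! π : Measure ℝ, TruncatedQueue.IsInvariantDistribution lam G π) ∧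
    IsGLB {γ : ℝ | ∃ (G : Measure ℝ) (lam : ℝ) (π : Measure ℝ),
      TruncatedQueue.IsServiceDistribution G ∧ 0 < lam ∧
        TruncatedQueue.IsInvariantDistribution lam G π ∧
          γ = 1 - TruncatedQueue.convergenceRate lam G π} 0 := by
  refine ⟨fun G lam hG hlam => TruncatedQueue.existsUnique_isInvariantDistribution hG hlam, ?_, ?_⟩
  · rintro γ ⟨G, lam, π, hG, hlam, hπ, rfl⟩
    have := hG.1
    have := hπ.1
    exact sub_nonneg.2 (TruncatedQueue.convergenceRate_le_one hlam)
  · intro b hb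
    by_contra! hpos
    -- A positive lower bound `b` is contradicted by taking `ε = b`.
    obtain ⟨lam, mu, hlam, hmu, h⟩ := TruncatedQueue.exists_lt_convergenceRate hpos
    have hG := TruncatedQueue.isServiceDistribution_expMeasure hmu
    obtain ⟨π, hπ, -⟩ := TruncatedQueue.existsUnique_isInvariantDistribution hG hlam
    have h1 := hb ⟨_, lam, π, hG, hlam, hπ, rfl⟩
    linarith [h π hπ.1]
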